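/- Let $n\ge 1$, $\alpha>0$, $a\in\mathbb R$, $b\ge 0$, $T\in(0,\infty]$. Let $\Omega\subset\mathbb R^n\times[0,T)$ be relatively open, let $u\colon\Omega\to[0,\infty)$ be continuous, and put $M_t=\operatorname{graph}u(\cdot,t)\subset\mathbb R^{n+1}$. Let $\nu$ be the unit normal of $M_t$ with $$w:=\langle\nu,e_{n+1}\rangle=\frac1{\sqrt{1+|\nabla u|^2}}>0 ,\qquad\text{and let}\qquad H=\operatorname{div}\Big(\frac{\nabla u}{\sqrt{1+|\nabla u|^2}}\Big)$$ be its mean curvature. Suppose that 1. on $\{(x,t)\in\Omega: u(x,t)<a+1\}$ the function $u$ is smooth (up to and including $t=0$), $H>0$, and $u$ solves the graphical $H^\alpha$-flow $\dfrac{\partial_t u}{\sqrt{1+|\nabla u|^2}}=H^\alpha$; 2. for every $t\in[0,T)$ the set $\{x:(x,t)\in\Omega,\ u(x,t)\le a\}$ is compact, and the set $\{(x,t)\in\Omega:u(x,t)\le a\}$ is closed in $\mathbb R^n\times[0,T)$ (so no piece of $M_t$ below height $a$ appears out of nothing at a positive time). At the point $X=(x,u(x,t))$ of $M_t$ let $\psi=(a-bt-X^{n+1})_+=\max\{a-bt-u(x,t),0\}$.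 Let $\inf_{t=0}\psi^{-1}w$ be the infimum over the points of $M_0$ with $\psi>0$, and let $$C:=\begin{cases}\inf\limits_{t=0}\psi^{-1}w, & \alpha\le 1,\\[1ex] \min\Big\{\inf\limits_{t=0}\psi^{-1}w,\ \dfrac{\alpha}{n(\alpha-1)},\ \dfrac{b}{a(\alpha-1)}\Big\}, & \alpha>1.\end{cases}$$ Then at every $(x,t)\in\Omega$ with $\psi(x,t)>0$ $$\psi^{-1}w\ \ge\ C .$$ Moreover, if $\alpha\le1$ or $b>0$, then at each such point $C>0$, and hence the local gradient estimate $\sqrt{1+|\nabla u(x,t)|^2}\le\dfrac1{C\,\psi(x,t)}$ holds. -/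

import Mathlib

open scoped ContDiff

noncomputable section

namespace HAlphaFlow

/-- The space `ℝⁿ` over which the hypersurfaces are graphs. -/
abbrev Base (n : ℕ) : Type := EuclideanSpace ℝ (Fin n)

/-- The ambient Euclidean space `ℝⁿ⁺¹ = ℝⁿ × ℝ`, with its `ℓ²` inner product. -/
abbrev Ambient (n : ℕ) : Type := WithLp 2 (Base n × ℝ)

/-- The last standard basis vector `e_{n+1} = (0, …, 0, 1)` of `ℝⁿ⁺¹`. -/
def eLast (n : ℕ) : Ambient n := WithLp.toLp 2 (0, 1)

/-- The divergence `∑ i, ∂ᵢ Vᵢ` of a vector field on `ℝⁿ`. -/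
def divergence {n : ℕ} (V : Base n → Base n) (x : Base n) : ℝ :=
  ∑ i : Fin n, (fderiv ℝ V x (EuclideanSpace.single i 1)) i

/-- The factor `√(1 + |∇f|²)` of the graph of `f`. -/
def areaFactor {n : ℕ} (f : Base n → ℝ) (x : Base n) : ℝ :=
  √(1 + ‖gradient f x‖ ^ 2)

/-- The unit normal `ν = (-∇f, 1) / √(1 + |∇f|²)` of the graph of `f` with `⟨ν, e_{n+1}⟩ > 0`. -/
def unitNormal {n : ℕ} (f : Base n → ℝ) (x : Base n) : Ambient n :=
  (areaFactor f x)⁻¹ • WithLp.toLp 2 (-gradient f x, 1)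

/-- The function `w = ⟨ν, e_{n+1}⟩`. -/
def normalHeight {n : ℕ} (f : Base n → ℝ) (x : Base n) : ℝ :=
  inner ℝ (unitNormal f x) (eLast n)

/-- `w = 1 / √(1 + |∇f|²)`. -/
theorem normalHeight_eq {n : ℕ} (f : Base n → ℝ) (x : Base n) :
    normalHeight f x = 1 / √(1 + ‖gradient f x‖ ^ 2) := by
  simp [normalHeight, unitNormal, eLast, areaFactor, inner_smul_left, WithLp.prod_inner_apply]

/-- The mean curvature `H = div (∇f / √(1 + |∇f|²))` of the graph of `f`, with respect to the
normal `unitNormal f` (so that it is nonnegative for convex `f`). -/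
def meanCurvature {n : ℕ} (f : Base n → ℝ) (x : Base n) : ℝ :=
  divergence (fun y => (areaFactor f y)⁻¹ • gradient f y) x

/-- The time slab `ℝⁿ × [0, T)`, where `T ∈ (0, ∞]`. -/
def slab (n : ℕ) (T : EReal) : Set (Base n × ℝ) :=
  {p | 0 ≤ p.2 ∧ (p.2 : EReal) < T}

/-- The graphs `M_t = {(x, u x t) | (x, t) ∈ Ω}`, `0 ≤ t < T`, are hypersurfaces in the upper
half-space whose part below height `a + 1` is smooth, strictly mean convex, and moves by the
graphical `H^α`-flow, and whose part up to height `a` is compact at every time.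
Only the values of `u` on `Ω` matter. -/
structure IsGraphFlowBelow (n : ℕ) (α a : ℝ) (T : EReal)
    (Ω : Set (Base n × ℝ)) (u : Base n → ℝ → ℝ) : Prop where
  /-- `Ω` is relatively open in `ℝⁿ × [0, T)`. -/
  isOpen_domain : ∃ U : Set (Base n × ℝ), IsOpen U ∧ Ω = U ∩ slab n T
  continuousOn : ContinuousOn (fun p : Base n × ℝ => u p.1 p.2) Ω
  nonneg : ∀ x t, (x, t) ∈ Ω → 0 ≤ u x t
  /-- Smoothness (up to and including `t = 0`) below height `a + 1`. -/
  smooth : ContDiffOn ℝ ∞ (fun p : Base n × ℝ => u p.1 p.2) {p ∈ Ω | u p.1 p.2 < a + 1}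
  meanConvex : ∀ x t, (x, t) ∈ Ω → u x t < a + 1 → 0 < meanCurvature (fun y => u y t) x
  /-- The equation `∂ₜu / √(1 + |∇u|²) = H^α`. -/
  flow : ∀ x t, (x, t) ∈ Ω → 0 < t → u x t < a + 1 →
    deriv (fun s => u x s) t / areaFactor (fun y => u y t) x =
      meanCurvature (fun y => u y t) x ^ α
  isCompact_sublevel : ∀ t : ℝ, 0 ≤ t → (t : EReal) < T →
    IsCompact {x : Base n | (x, t) ∈ Ω ∧ u x t ≤ a}
  /-- The part up to height `a` of the space-time track is closed in `ℝⁿ × [0, T)`: no piece of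
  `M_t` below height `a` appears out of nothing at a positive time. -/
  isClosed_sublevel : ∃ F : Set (Base n × ℝ), IsClosed F ∧
    {p ∈ Ω | u p.1 p.2 ≤ a} = F ∩ slab n T

/-- The localization function `ψ = (a - b t - X^{n+1})₊` at the point `X = (x, u x t)`. -/
def psi {n : ℕ} (a b : ℝ) (u : Base n → ℝ → ℝ) (x : Base n) (t : ℝ) : ℝ :=
  max (a - b * t - u x t) 0

/-- The quotient `ψ⁻¹ w` at the point `(x, u x t)` of `M_t`. -/
def psiInvW {n : ℕ} (a b : ℝ) (u : Base n → ℝ → ℝ) (x : Base n) (t : ℝ) : ℝ :=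
  (psi a b u x t)⁻¹ * normalHeight (fun y => u y t) x

/-- The infimum of `ψ⁻¹ w` at time `t = 0`, over the points where `ψ > 0`. -/
def initialInf {n : ℕ} (a b : ℝ) (Ω : Set (Base n × ℝ)) (u : Base n → ℝ → ℝ) : ℝ :=
  sInf ((fun x => psiInvW a b u x 0) '' {x | (x, 0) ∈ Ω ∧ 0 < psi a b u x 0})

/-- The right-hand side of the gradient bound. -/
def gradientConst {n : ℕ} (α a b : ℝ) (Ω : Set (Base n × ℝ)) (u : Base n → ℝ → ℝ) : ℝ :=
  if α ≤ 1 then initialInf a b Ω u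
  else min (initialInf a b Ω u) (min (α / (n * (α - 1))) (b / (a * (α - 1))))

end HAlphaFlow

end

/-!
The proof is the maximum principle for `f = W ψ`, where `W = √(1 + |∇u|²)` and
`ψ = a - b t - u`; where `ψ > 0` this is the reciprocal of `ψ⁻¹ w`. With `C` the constant of the
theorem, the claim is `C f ≤ 1`.

*Compactness.* Below height `a + 1` the flow equation gives `∂ₜu > 0`. Hence a point of the track
with `u ≤ a` can be followed back in time with decreasing height, and by closedness down to `t = 0`
(`IsGraphFlowBelow.mem_of_le`). The track up to height `a` and up to time `t` therefore lies over
the compact initial slice and is compact, and `f`, continuous up to `t = 0`, attains its maximum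
there. If the maximum is at `t = 0`, the initial infimum bounds it.

*Evolution inequality.* Suppose that the maximum is positive and attained at `t > 0`, and write
`p = ∇u`. At that point `∇W = (W / ψ) p`, so that `D²u p = (W² / ψ) p`. Differentiating
`W² = 1 + |p|²` twice and the formula `W² H = W Δu - ⟨p, ∇W⟩` once, and contracting the condition
`D²f ≤ 0` with the nonnegative form `W² δ - p ⊗ p`, one finds
`ψ ⟨p, ∇H⟩ ≤ H - W ψ |A|²`, with `|A|² ≥ H² / n` (`inner_grad_curvature_le`). All other terms
cancel. Substituting this and the spatial derivative of `∂ₜu = W H^α` into `∂ₜf ≥ 0` gives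
`0 ≤ (α - 1) H^α - α W ψ H^(α-1) |A|² - b W` (`interior_max_inequality`).

*Conclusion.* If `C f > 1` at the maximum, the last inequality fails, by
`α - 1 ≤ 0` and `H > 0` when `α ≤ 1`, and by the two extra bounds on `C` when `α > 1` (`not_max_of_large`).
-/

open scoped Topology
open Filter

namespace HAlphaFlow

/-! ### Algebra at a critical point -/

/-- The squared trace of a matrix is at most `n` times its squared Frobenius norm. -/
theorem sq_sum_diag_le {n : ℕ} (A : Fin n → Fin n → ℝ) :
    (∑ i, A i i) ^ 2 ≤ n * ∑ i, ∑ j, A i j ^ 2 := by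
  calc (∑ i, A i i) ^ 2 ≤ n * ∑ i, A i i ^ 2 := by
        simpa using sq_sum_le_card_mul_sum_sq (s := Finset.univ) (f := fun i => A i i)
    _ ≤ n * ∑ i, ∑ j, A i j ^ 2 := by
        gcongr with i
        exact Finset.single_le_sum (f := fun j => A i j ^ 2) (fun j _ => sq_nonneg _)
          (Finset.mem_univ i)

/-- The pointwise algebra of the maximum principle at a spatial critical point of `W ψ`, where
`W = √(1 + |∇u|²)`. The letters stand for derivatives at the point: `p = ∇u`, `S = D²u`,
`w = ∇W`, `w2 = D²W`, `h = ∇H`, and `T k i = ∂ᵢ∂ᵢ∂ₖu`. The hypotheses `hW1`, `hW2` are the first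
and second derivatives of `W² = 1 + |∇u|²`, and `hH`, `hH1` the formula for the mean curvature and
its gradient. `hcrit` says that `W ψ` is critical, so that `p` is an eigenvector of `S`; `hmax` is
the second order condition, contracted with `W² δᵢₖ - pᵢ pₖ`. -/
theorem inner_grad_curvature_le {n : ℕ} (hn : 1 ≤ n) {p w h : Fin n → ℝ}
    {S T w2 : Fin n → Fin n → ℝ} {W ψ H : ℝ} (hW0 : 0 < W) (hψ : 0 < ψ)
    (hS : ∀ i j, S i j = S j i)
    (hW : W * W = 1 + ∑ k, p k * p k)
    (hW1 : ∀ i, W * w i = ∑ k, p k * S k i)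
    (hW2 : ∀ i, w i * w i + W * w2 i i = ∑ k, (S k i * S k i + p k * T k i))
    (hH : W * W * H = W * ∑ i, S i i - ∑ i, p i * w i)
    (hH1 : ∀ k, 2 * W * w k * H + W * W * h k =
      w k * ∑ i, S i i + W * ∑ i, T k i - ∑ i, (S i k * w i + p i * w2 i k))
    (hcrit : ∀ i, ψ * w i = W * p i)
    (hmax : W * W * ∑ i, (w2 i i * ψ - 2 * (w i * p i) - W * S i i) -
      ∑ i, ∑ k, p i * p k * (w2 i k * ψ - w i * p k - w k * p i - W * S i k) ≤ 0) :
    ψ * ∑ k, p k * h k ≤ H - W * ψ * (H ^ 2 / n) := by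
  have hn' : (0 : ℝ) < n := by exact_mod_cast hn
  -- `∇W = l p` with `l = W / ψ`.
  obtain ⟨l, hl⟩ : ∃ l, l = W / ψ := ⟨_, rfl⟩
  have hlψ : l * ψ = W := by rw [hl]; field_simp
  have hw : ∀ i, w i = l * p i := fun i => by
    have := hcrit i
    apply mul_left_cancel₀ hψ.ne'
    rw [this, ← hlψ]; ring
  have hSp : ∀ i, ∑ k, p k * S k i = W * l * p i := fun i => by
    rw [← hW1, hw]; ring
  obtain ⟨P, hP⟩ : ∃ P, P = ∑ k, p k * p k := ⟨_, rfl⟩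
  obtain ⟨tr, htr⟩ : ∃ tr, tr = ∑ i, S i i := ⟨_, rfl⟩
  obtain ⟨SS, hSS⟩ : ∃ SS, SS = ∑ i, ∑ k, S k i * S k i := ⟨_, rfl⟩
  obtain ⟨TT, hTT⟩ : ∃ TT, TT = ∑ k, p k * ∑ i, T k i := ⟨_, rfl⟩
  obtain ⟨X, hX⟩ : ∃ X, X = ∑ i, w2 i i := ⟨_, rfl⟩
  obtain ⟨Y, hY⟩ : ∃ Y, Y = ∑ i, ∑ k, p i * p k * w2 i k := ⟨_, rfl⟩
  obtain ⟨ph, hph⟩ : ∃ ph, ph = ∑ k, p k * h k := ⟨_, rfl⟩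
  have hpw : ∑ i, p i * w i = l * P := by
    rw [hP, Finset.mul_sum]; exact Finset.sum_congr rfl fun i _ => by rw [hw]; ring
  have hSpp : ∑ i, ∑ k, p i * p k * S i k = W * l * P := by
    rw [Finset.sum_comm, hP, Finset.mul_sum]
    refine Finset.sum_congr rfl fun k _ => ?_
    calc _ = p k * ∑ i, p i * S i k := by
          rw [Finset.mul_sum]; exact Finset.sum_congr rfl fun i _ => by ring
      _ = _ := by rw [hSp]; ring
  have hPP : ∑ i, ∑ k, p i * p k * (p i * p k) = P * P := by
    rw [hP, Finset.sum_mul_sum]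
    exact Finset.sum_congr rfl fun i _ => Finset.sum_congr rfl fun k _ => by ring
  have e1 : l ^ 2 * P + W * X = SS + TT := by
    have := Finset.sum_congr rfl fun i (_ : i ∈ Finset.univ) => hW2 i
    simp only [Finset.sum_add_distrib, ← Finset.mul_sum] at this
    rw [← hX, ← hSS] at this
    have h1 : ∑ i, w i * w i = l ^ 2 * P := by
      rw [hP, Finset.mul_sum]; exact Finset.sum_congr rfl fun i _ => by rw [hw]; ring
    have h2 : ∑ i, ∑ k, p k * T k i = TT := by
      rw [Finset.sum_comm, hTT]; simp only [Finset.mul_sum]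
    rw [h1, h2] at this
    exact this
  have e2 : W * W * H = W * tr - l * P := by rw [hH, hpw, htr]
  have e3 : 2 * W * l * P * H + W * W * ph = l * P * tr + W * TT - W * l ^ 2 * P - Y := by
    have h0 := Finset.sum_congr rfl fun k (_ : k ∈ Finset.univ) => congrArg (p k * ·) (hH1 k)
    beta_reduce at h0
    have h1 : ∑ k, p k * (2 * W * w k * H + W * W * h k) = 2 * W * l * P * H + W * W * ph := by
      rw [← mul_comm H, hP, hph, Finset.mul_sum, Finset.mul_sum, Finset.mul_sum,
        ← Finset.sum_add_distrib]
      exact Finset.sum_congr rfl fun i _ => by rw [hw]; ring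
    have h2 : ∑ k, p k * ∑ i, (S i k * w i + p i * w2 i k) = W * l ^ 2 * P + Y := by
      have : ∀ k, p k * ∑ i, (S i k * w i + p i * w2 i k) =
          W * l ^ 2 * (p k * p k) + ∑ i, p i * p k * w2 i k := fun k => by
        rw [Finset.sum_add_distrib, mul_add, Finset.mul_sum (f := fun i => p i * w2 i k)]
        congr 1
        · have : ∑ i, S i k * w i = l * ∑ i, p i * S i k := by
            rw [Finset.mul_sum]; exact Finset.sum_congr rfl fun i _ => by rw [hw]; ring
          rw [this, hSp]; ring
        · exact Finset.sum_congr rfl fun i _ => by ring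
      rw [Finset.sum_congr rfl fun k _ => this k, Finset.sum_add_distrib, ← Finset.mul_sum, ← hP,
        hY, Finset.sum_comm]
    have h3 : ∑ k, p k * (w k * ∑ i, S i i + W * ∑ i, T k i - ∑ i, (S i k * w i + p i * w2 i k))
        = l * P * tr + W * TT - (W * l ^ 2 * P + Y) := by
      rw [← h2, hTT, hP, Finset.mul_sum, Finset.mul_sum, Finset.sum_mul, ← Finset.sum_add_distrib,
        ← Finset.sum_sub_distrib]
      refine Finset.sum_congr rfl fun k _ => ?_
      rw [hw, htr]; ring
    rw [h1, h3] at h0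
    linarith
  have e4 : W * W * (ψ * X - 2 * l * P - W * tr) -
      (ψ * Y - 2 * l * (P * P) - W * (W * l * P)) ≤ 0 := by
    have h1 : ∑ i, (w2 i i * ψ - 2 * (w i * p i) - W * S i i) = ψ * X - 2 * l * P - W * tr := by
      rw [hX, hP, htr, Finset.mul_sum, Finset.mul_sum, Finset.mul_sum, ← Finset.sum_sub_distrib,
        ← Finset.sum_sub_distrib]
      exact Finset.sum_congr rfl fun i _ => by rw [hw]; ring
    have h2 : ∑ i, ∑ k, p i * p k * (w2 i k * ψ - w i * p k - w k * p i - W * S i k) =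
        ψ * Y - 2 * l * (P * P) - W * (W * l * P) := by
      rw [hY, ← hPP, ← hSpp]
      simp only [Finset.mul_sum, ← Finset.sum_sub_distrib]
      exact Finset.sum_congr rfl fun i _ => Finset.sum_congr rfl fun k _ => by
        rw [hw, hw]; ring
    rw [h1, h2] at hmax
    exact hmax
  -- As `p` is an eigenvector of `S`, the shape operator is a symmetric matrix, namely `W⁻²` times
  -- the one squared here. This makes `|A|² ≥ H² / n` a case of the Cauchy-Schwarz inequality.
  have eA : ∑ i, ∑ k, (W * S i k - l * (p i * p k)) ^ 2 =
      W ^ 2 * SS - 2 * W * l * (W * l * P) + l ^ 2 * (P * P) := by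
    rw [← hPP, ← hSpp, hSS]
    simp only [Finset.mul_sum, ← Finset.sum_sub_distrib, ← Finset.sum_add_distrib]
    exact Finset.sum_congr rfl fun i _ => Finset.sum_congr rfl fun k _ => by
      rw [hS k i]; ring
  have etr : ∑ i, (W * S i i - l * (p i * p i)) = W * W * H := by
    rw [Finset.sum_sub_distrib, ← Finset.mul_sum, ← Finset.mul_sum, ← hP, ← htr, e2]
  have hCS := sq_sum_diag_le fun i k => W * S i k - l * (p i * p k)
  rw [eA, etr] at hCS
  rw [← hP] at hW
  rw [← hph]
  have hP' : P = W * W - 1 := by linarith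
  have hCS' : W ^ 4 * (H ^ 2 / n) ≤ W ^ 2 * SS - 2 * W * l * (W * l * P) + l ^ 2 * (P * P) := by
    rw [mul_div_assoc', div_le_iff₀ hn']; linarith
  have htr' : W * tr = W * W * H + l * P := by linarith
  have key : W ^ 3 * (ψ * ph) ≤ W ^ 3 * (H - W * ψ * (H ^ 2 / n)) := by
    have k1 : W ^ 3 * (ψ * ph) =
        W * (ψ * (W * W * X - Y)) + W * (l * ψ) * P * tr - ψ * (W ^ 2 * SS)
          - 2 * W ^ 2 * (l * ψ) * P * H := by
      linear_combination W * ψ * e3 - W ^ 2 * ψ * e1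
    have k2 : W * (ψ * (W * W * X - Y)) ≤
        W * (W * W * (2 * l * P + W * tr) - 2 * l * (P * P) - W * (W * l * P)) := by
      apply mul_le_mul_of_nonneg_left _ hW0.le
      linarith
    have k3 : ψ * (W ^ 4 * (H ^ 2 / n)) + 2 * W ^ 2 * (l * (l * ψ)) * P - l * (l * ψ) * P * P ≤
        ψ * (W ^ 2 * SS) := by
      have := mul_le_mul_of_nonneg_left hCS' hψ.le
      linarith
    rw [hlψ] at k1 k3
    have k4 : W * (W * W * (2 * l * P + W * tr) - 2 * l * (P * P) - W * (W * l * P)) +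
        W * W * P * tr - (2 * W ^ 2 * (l * W) * P - l * W * P * P) - 2 * W ^ 2 * W * P * H =
        W ^ 3 * H := by
      linear_combination (W * P + W ^ 3) * htr' - W ^ 3 * H * hP'
    linarith
  exact le_of_mul_le_mul_left key (by positivity)

/-! ### Directional derivatives -/

section Calculus

variable {Z : Type*} [NormedAddCommGroup Z] [NormedSpace ℝ Z]

/-- The derivative of `F` in the constant direction `v`, as a function of the point. -/
noncomputable def pd (v : Z) (F : Z → ℝ) (z : Z) : ℝ := fderiv ℝ F z v

variable {F G : Z → ℝ} {v w z : Z}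

theorem contDiffAt_pd (h : ContDiffAt ℝ ∞ F z) : ContDiffAt ℝ ∞ (pd v F) z :=
  (h.fderiv_right (m := ∞) (by simp)).clm_apply contDiffAt_const

theorem differentiableAt_of_smooth (h : ContDiffAt ℝ ∞ F z) : DifferentiableAt ℝ F z :=
  h.differentiableAt (by simp)

theorem pd_congr (h : F =ᶠ[𝓝 z] G) : pd v F z = pd v G z := by
  unfold pd; rw [h.fderiv_eq]

theorem pd_comm (h : ContDiffAt ℝ ∞ F z) : pd v (pd w F) z = pd w (pd v F) z := by
  have hd : DifferentiableAt ℝ (fderiv ℝ F) z :=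
    (h.fderiv_right (m := ∞) (by simp)).differentiableAt (by simp)
  have key : ∀ a b : Z, pd a (pd b F) z = fderiv ℝ (fderiv ℝ F) z a b := fun a b => by
    have : HasFDerivAt (pd b F) _ z := hd.hasFDerivAt.clm_apply (hasFDerivAt_const b z)
    rw [pd, this.fderiv]; simp
  rw [key, key]
  exact (h.isSymmSndFDerivAt (by
    rw [minSmoothness_of_isRCLikeNormedField]
    exact WithTop.coe_le_coe.2 (le_top : (2 : ℕ∞) ≤ ⊤))).eq v w

theorem pd_const (c : ℝ) : pd v (fun _ => c) z = 0 := by simp [pd]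

theorem pd_add (hF : ContDiffAt ℝ ∞ F z) (hG : ContDiffAt ℝ ∞ G z) :
    pd v (fun y => F y + G y) z = pd v F z + pd v G z := by
  simp [pd, fderiv_fun_add (differentiableAt_of_smooth hF) (differentiableAt_of_smooth hG)]

theorem pd_sub (hF : ContDiffAt ℝ ∞ F z) (hG : ContDiffAt ℝ ∞ G z) :
    pd v (fun y => F y - G y) z = pd v F z - pd v G z := by
  simp [pd, fderiv_fun_sub (differentiableAt_of_smooth hF) (differentiableAt_of_smooth hG)]

theorem pd_mul (hF : ContDiffAt ℝ ∞ F z) (hG : ContDiffAt ℝ ∞ G z) :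
    pd v (fun y => F y * G y) z = pd v F z * G z + F z * pd v G z := by
  simp [pd, fderiv_fun_mul (differentiableAt_of_smooth hF) (differentiableAt_of_smooth hG)]
  ring

theorem pd_sum {ι : Type*} [Fintype ι] {F : ι → Z → ℝ} (hF : ∀ i, ContDiffAt ℝ ∞ (F i) z) :
    pd v (fun y => ∑ i, F i y) z = ∑ i, pd v (F i) z := by
  simp [pd, fderiv_fun_sum fun i _ => differentiableAt_of_smooth (hF i)]

theorem pd_rpow (hF : ContDiffAt ℝ ∞ F z) (h0 : 0 < F z) (α : ℝ) :
    pd v (fun y => F y ^ α) z = α * F z ^ (α - 1) * pd v F z := by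
  have := (differentiableAt_of_smooth hF).hasFDerivAt.rpow_const (p := α) (Or.inl h0.ne')
  simp [pd, this.fderiv]

theorem hasDerivAt_line (hF : DifferentiableAt ℝ F z) :
    HasDerivAt (fun s : ℝ => F (z + s • v)) (pd v F z) 0 := by
  have : HasFDerivAt F (fderiv ℝ F z) (z + (0 : ℝ) • v) := by simpa using hF.hasFDerivAt
  have h2 : HasDerivAt (fun s : ℝ => z + s • v) v 0 := by
    simpa using ((hasDerivAt_id (0 : ℝ)).smul_const v).const_add z
  exact this.comp_hasDerivAt (0 : ℝ) h2

theorem deriv_line {s : ℝ} (hF : DifferentiableAt ℝ F (z + s • v)) :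
    deriv (fun s : ℝ => F (z + s • v)) s = pd v F (z + s • v) := by
  have h2 : HasDerivAt (fun s : ℝ => z + s • v) v s := by
    simpa using ((hasDerivAt_id s).smul_const v).const_add z
  exact (hF.hasFDerivAt.comp_hasDerivAt s h2).deriv

theorem tendsto_line : Tendsto (fun s : ℝ => z + s • v) (𝓝 0) (𝓝 z) := by
  have : Continuous (fun s : ℝ => z + s • v) := by fun_prop
  simpa using this.tendsto 0

theorem pd_eq_zero_of_isLocalMax (hF : DifferentiableAt ℝ F z)
    (hmax : ∀ᶠ s in 𝓝 (0 : ℝ), F (z + s • v) ≤ F z) : pd v F z = 0 :=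
  IsLocalMax.hasDerivAt_eq_zero (f := fun s : ℝ => F (z + s • v)) (a := 0)
    (by simpa [IsLocalMax, IsMaxFilter] using hmax) (hasDerivAt_line hF)

theorem pd_pd_nonpos_of_isLocalMax (hF : ∀ᶠ y in 𝓝 z, ContDiffAt ℝ ∞ F y)
    (hmax : ∀ᶠ s in 𝓝 (0 : ℝ), F (z + s • v) ≤ F z) : pd v (pd v F) z ≤ 0 := by
  have hz := hF.self_of_nhds
  set g : ℝ → ℝ := fun s => F (z + s • v) with hg
  have hd : deriv g =ᶠ[𝓝 0] fun s => pd v F (z + s • v) :=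
    (tendsto_line.eventually hF).mono fun s hs => deriv_line (differentiableAt_of_smooth hs)
  have hdd : deriv (deriv g) 0 = pd v (pd v F) z := by
    rw [hd.deriv_eq]
    exact (hasDerivAt_line (differentiableAt_of_smooth (contDiffAt_pd hz))).deriv
  by_contra! hpos
  have hd0 : deriv g 0 = 0 := by
    rw [hd.self_of_nhds]
    simpa using pd_eq_zero_of_isLocalMax (differentiableAt_of_smooth hz) hmax
  have hmin := isLocalMin_of_deriv_deriv_pos (f := g) (x₀ := 0) (by rw [hdd]; exact hpos) hd0
    (hasDerivAt_line (differentiableAt_of_smooth hz)).continuousAt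
  -- `g` has both a local maximum and a local minimum, so it is locally constant.
  have hconst : g =ᶠ[𝓝 0] fun _ => F z := by
    filter_upwards [hmin, hmax] with s h1 h2
    exact le_antisymm h2 (by simpa [hg] using h1)
  have : deriv (deriv g) 0 = 0 := by
    rw [hconst.deriv.deriv_eq]; simp
  rw [hdd] at this
  exact hpos.ne' this

/-- The one-sided first order condition in time: the maximum is taken over earlier times only. -/
theorem pd_nonneg_of_le_left (hF : DifferentiableAt ℝ F z)
    (hmax : ∀ᶠ s in 𝓝[<] (0 : ℝ), F (z + s • v) ≤ F z) : 0 ≤ pd v F z := by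
  have h := (hasDerivAt_iff_tendsto_slope_left_right.1 (hasDerivAt_line (v := v) hF)).1
  refine ge_of_tendsto h ?_
  filter_upwards [hmax, self_mem_nhdsWithin] with s hs hs0
  rw [slope_def_field]
  simp only [zero_smul, add_zero, sub_zero]
  exact div_nonneg_of_nonpos (by linarith) (le_of_lt hs0)

theorem pd_direction_sub (c d : ℝ) : pd (c • v - d • w) F =
    fun y => c * pd v F y - d * pd w F y := by
  funext y; simp [pd]

/-- At a maximum in all the directions spanned by the `e i`, the Hessian `M` satisfies
`(1 + |p|²) tr M - M(p, p) ≤ 0`: here `tr M ≤ 0`, and `|p|² tr M - M(p, p)` is half the sum of the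
second derivatives in the directions `pₖ eᵢ - pᵢ eₖ`. -/
theorem trace_sub_quadratic_le {n : ℕ} {e : Fin n → Z} (p : Fin n → ℝ)
    (hF : ∀ᶠ y in 𝓝 z, ContDiffAt ℝ ∞ F y)
    (hmax : ∀ v ∈ Submodule.span ℝ (Set.range e), ∀ᶠ s in 𝓝 (0 : ℝ), F (z + s • v) ≤ F z) :
    (1 + ∑ k, p k * p k) * ∑ i, pd (e i) (pd (e i) F) z -
      ∑ i, ∑ k, p i * p k * pd (e k) (pd (e i) F) z ≤ 0 := by
  have hz := hF.self_of_nhds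
  have he : ∀ i, e i ∈ Submodule.span ℝ (Set.range e) := fun i =>
    Submodule.subset_span ⟨i, rfl⟩
  have h1 : ∑ i, pd (e i) (pd (e i) F) z ≤ 0 :=
    Finset.sum_nonpos fun i _ => pd_pd_nonpos_of_isLocalMax hF (hmax _ (he i))
  have h2 : ∀ i k, p k * p k * pd (e i) (pd (e i) F) z + p i * p i * pd (e k) (pd (e k) F) z -
      2 * (p i * p k * pd (e k) (pd (e i) F) z) ≤ 0 := fun i k => by
    have := pd_pd_nonpos_of_isLocalMax (v := p k • e i - p i • e k) hF (hmax _
      (Submodule.sub_mem _ (Submodule.smul_mem _ _ (he i)) (Submodule.smul_mem _ _ (he k))))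
    rw [pd_direction_sub, pd_direction_sub] at this
    have h3 : ∀ a : Z, pd a (fun y => p k * pd (e i) F y - p i * pd (e k) F y) z =
        p k * pd a (pd (e i) F) z - p i * pd a (pd (e k) F) z := fun a => by
      rw [pd_sub (contDiffAt_const.mul (contDiffAt_pd hz))
          (contDiffAt_const.mul (contDiffAt_pd hz)),
        pd_mul contDiffAt_const (contDiffAt_pd hz), pd_mul contDiffAt_const (contDiffAt_pd hz),
        pd_const, pd_const]
      ring
    beta_reduce at this
    rw [h3, h3, pd_comm (v := e i) (w := e k) hz] at this
    linarith
  have h4 := Finset.sum_nonpos fun i (_ : i ∈ Finset.univ) =>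
    Finset.sum_nonpos fun k (_ : k ∈ Finset.univ) => h2 i k
  simp only [Finset.sum_sub_distrib, Finset.sum_add_distrib, ← Finset.mul_sum,
    ← Finset.sum_mul] at h4
  linarith

end Calculus

/-! ### Geometry of the time slices and the evolution inequality -/

/-- The spatial coordinate direction `(eᵢ, 0)` of space-time. -/
noncomputable def spaceDir {n : ℕ} (i : Fin n) : Base n × ℝ := (EuclideanSpace.single i 1, 0)

/-- The time direction `(0, 1)` of space-time. -/
def timeDir (n : ℕ) : Base n × ℝ := (0, 1)

/-- The area factor `√(1 + |∇u|²)` as a function on space-time; only the spatial derivatives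
of `U` enter. -/
noncomputable def slopeFactor {n : ℕ} (U : Base n × ℝ → ℝ) (z : Base n × ℝ) : ℝ :=
  √(1 + ∑ k, pd (spaceDir k) U z * pd (spaceDir k) U z)

section

variable {n : ℕ} {U : Base n × ℝ → ℝ} {z : Base n × ℝ}

theorem one_add_sum_pos (U : Base n × ℝ → ℝ) (z : Base n × ℝ) :
    0 < 1 + ∑ k, pd (spaceDir k) U z * pd (spaceDir k) U z := by
  have : 0 ≤ ∑ k, pd (spaceDir k) U z * pd (spaceDir k) U z :=
    Finset.sum_nonneg fun k _ => mul_self_nonneg _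
  linarith

theorem slopeFactor_pos (U : Base n × ℝ → ℝ) (z : Base n × ℝ) : 0 < slopeFactor U z :=
  Real.sqrt_pos.2 (one_add_sum_pos U z)

theorem slopeFactor_mul_self (U : Base n × ℝ → ℝ) (z : Base n × ℝ) :
    slopeFactor U z * slopeFactor U z = 1 + ∑ k, pd (spaceDir k) U z * pd (spaceDir k) U z :=
  Real.mul_self_sqrt (one_add_sum_pos U z).le

theorem contDiffAt_slopeFactor (h : ContDiffAt ℝ ∞ U z) : ContDiffAt ℝ ∞ (slopeFactor U) z :=
  ContDiffAt.sqrt (contDiffAt_const.add (ContDiffAt.sum fun _ _ =>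
    (contDiffAt_pd h).mul (contDiffAt_pd h))) (one_add_sum_pos U z).ne'

/-- The first derivative of `W² = 1 + |∇u|²`. -/
theorem slopeFactor_mul_pd (h : ContDiffAt ℝ ∞ U z) (v : Base n × ℝ) :
    slopeFactor U z * pd v (slopeFactor U) z =
      ∑ k, pd (spaceDir k) U z * pd v (pd (spaceDir k) U) z := by
  have hW := contDiffAt_slopeFactor h
  have hp : ∀ k, ContDiffAt ℝ ∞ (pd (spaceDir k) U) z := fun k => contDiffAt_pd h
  have e := pd_congr (v := v) (z := z) (Eventually.of_forall (slopeFactor_mul_self U))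
  rw [pd_mul hW hW, pd_add contDiffAt_const (ContDiffAt.sum fun k _ => (hp k).mul (hp k)),
    pd_const, pd_sum fun k => (hp k).mul (hp k)] at e
  have e2 : ∀ k, pd v (fun y => pd (spaceDir k) U y * pd (spaceDir k) U y) z =
      2 * (pd (spaceDir k) U z * pd v (pd (spaceDir k) U) z) := fun k => by
    rw [pd_mul (hp k) (hp k)]; ring
  rw [Finset.sum_congr rfl fun k _ => e2 k, ← Finset.mul_sum] at e
  linarith

/-- The second derivative of `W² = 1 + |∇u|²`. -/
theorem slopeFactor_second (h : ∀ᶠ y in 𝓝 z, ContDiffAt ℝ ∞ U y) (v : Base n × ℝ) :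
    pd v (slopeFactor U) z * pd v (slopeFactor U) z +
        slopeFactor U z * pd v (pd v (slopeFactor U)) z =
      ∑ k, (pd v (pd (spaceDir k) U) z * pd v (pd (spaceDir k) U) z +
        pd (spaceDir k) U z * pd v (pd v (pd (spaceDir k) U)) z) := by
  have hz := h.self_of_nhds
  have hW := contDiffAt_slopeFactor hz
  have hp : ∀ k, ContDiffAt ℝ ∞ (pd (spaceDir k) U) z := fun k => contDiffAt_pd hz
  have e := pd_congr (v := v) (h.mono fun y hy => slopeFactor_mul_pd hy v)
  rw [pd_mul hW (contDiffAt_pd hW), pd_sum fun k => (hp k).mul (contDiffAt_pd (hp k))] at e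
  rw [e]
  exact Finset.sum_congr rfl fun k _ => pd_mul (hp k) (contDiffAt_pd (hp k))

/-- The mean curvature of the time slices, as a function on space-time. -/
noncomputable def sliceCurvature (U : Base n × ℝ → ℝ) (z : Base n × ℝ) : ℝ :=
  ∑ i, pd (spaceDir i) (fun y => (slopeFactor U y)⁻¹ * pd (spaceDir i) U y) z

theorem contDiffAt_normal (h : ContDiffAt ℝ ∞ U z) (i : Fin n) :
    ContDiffAt ℝ ∞ (fun y => (slopeFactor U y)⁻¹ * pd (spaceDir i) U y) z :=
  ((contDiffAt_slopeFactor h).inv (slopeFactor_pos U z).ne').mul (contDiffAt_pd h)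

theorem contDiffAt_sliceCurvature (h : ContDiffAt ℝ ∞ U z) :
    ContDiffAt ℝ ∞ (sliceCurvature U) z :=
  ContDiffAt.sum fun i _ => contDiffAt_pd (contDiffAt_normal h i)

/-- The expanded divergence `W² H = W Δu - ⟨∇u, ∇W⟩`. -/
theorem sq_mul_sliceCurvature (h : ContDiffAt ℝ ∞ U z) :
    slopeFactor U z * slopeFactor U z * sliceCurvature U z =
      slopeFactor U z * ∑ i, pd (spaceDir i) (pd (spaceDir i) U) z -
        ∑ i, pd (spaceDir i) U z * pd (spaceDir i) (slopeFactor U) z := by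
  have hW := contDiffAt_slopeFactor h
  have e : ∀ i, slopeFactor U z * slopeFactor U z *
      pd (spaceDir i) (fun y => (slopeFactor U y)⁻¹ * pd (spaceDir i) U y) z =
      slopeFactor U z * pd (spaceDir i) (pd (spaceDir i) U) z -
        pd (spaceDir i) U z * pd (spaceDir i) (slopeFactor U) z := fun i => by
    have h1 := pd_mul (v := spaceDir i) hW (contDiffAt_normal h i)
    have h2 : ∀ y, slopeFactor U y * ((slopeFactor U y)⁻¹ * pd (spaceDir i) U y) =
        pd (spaceDir i) U y := fun y => mul_inv_cancel_left₀ (slopeFactor_pos U y).ne' _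
    simp only [h2] at h1
    rw [show pd (spaceDir i) (fun y => pd (spaceDir i) U y) z =
      pd (spaceDir i) (pd (spaceDir i) U) z from rfl] at h1
    rw [h1]
    have := h2 z
    linear_combination -(pd (spaceDir i) (slopeFactor U) z * this)
  rw [sliceCurvature, Finset.mul_sum, Finset.mul_sum, ← Finset.sum_sub_distrib]
  exact Finset.sum_congr rfl fun i _ => e i

theorem sq_mul_pd_sliceCurvature (h : ∀ᶠ y in 𝓝 z, ContDiffAt ℝ ∞ U y) (v : Base n × ℝ) :
    2 * slopeFactor U z * pd v (slopeFactor U) z * sliceCurvature U z +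
        slopeFactor U z * slopeFactor U z * pd v (sliceCurvature U) z =
      pd v (slopeFactor U) z * ∑ i, pd (spaceDir i) (pd (spaceDir i) U) z +
        slopeFactor U z * ∑ i, pd v (pd (spaceDir i) (pd (spaceDir i) U)) z -
        ∑ i, (pd v (pd (spaceDir i) U) z * pd (spaceDir i) (slopeFactor U) z +
          pd (spaceDir i) U z * pd v (pd (spaceDir i) (slopeFactor U)) z) := by
  have hz := h.self_of_nhds
  have hW := contDiffAt_slopeFactor hz
  have hp : ∀ k, ContDiffAt ℝ ∞ (pd (spaceDir k) U) z := fun k => contDiffAt_pd hz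
  have hS : ContDiffAt ℝ ∞ (fun y => ∑ i, pd (spaceDir i) (pd (spaceDir i) U) y) z :=
    ContDiffAt.sum fun i _ => contDiffAt_pd (hp i)
  have hq : ∀ i, ContDiffAt ℝ ∞
      (fun y => pd (spaceDir i) U y * pd (spaceDir i) (slopeFactor U) y) z :=
    fun i => (hp i).mul (contDiffAt_pd hW)
  have e := pd_congr (v := v) (h.mono fun y hy => sq_mul_sliceCurvature hy)
  rw [pd_mul (hW.mul hW) (contDiffAt_sliceCurvature hz), pd_mul hW hW,
    pd_sub (hW.mul hS) (ContDiffAt.sum fun i _ => hq i), pd_mul hW hS,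
    pd_sum fun i => contDiffAt_pd (hp i), pd_sum hq] at e
  rw [← Finset.sum_congr rfl fun i _ => pd_mul (v := v) (hp i) (contDiffAt_pd (v := spaceDir i) hW)]
  linear_combination e

/-- The function `√(1 + |∇u|²) (a - b t - u)`, the reciprocal of `ψ⁻¹ w` where `ψ > 0`. -/
noncomputable def testFun (a b : ℝ) (U : Base n × ℝ → ℝ) (z : Base n × ℝ) : ℝ :=
  slopeFactor U z * (a - b * z.2 - U z)

theorem contDiffAt_cut (a b : ℝ) (h : ContDiffAt ℝ ∞ U z) :
    ContDiffAt ℝ ∞ (fun y => a - b * y.2 - U y) z :=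
  (contDiffAt_const.sub (contDiffAt_const.mul contDiffAt_snd)).sub h

theorem pd_cut (a b : ℝ) (h : ContDiffAt ℝ ∞ U z) (v : Base n × ℝ) :
    pd v (fun y => a - b * y.2 - U y) z = -(b * v.2) - pd v U z := by
  rw [pd_sub (contDiffAt_const.sub (contDiffAt_const.mul contDiffAt_snd)) h,
    pd_sub contDiffAt_const (contDiffAt_const.mul contDiffAt_snd),
    pd_mul contDiffAt_const contDiffAt_snd, pd_const, pd_const]
  have : pd v (fun y : Base n × ℝ => y.2) z = v.2 := by
    have : HasFDerivAt (fun y : Base n × ℝ => y.2) (ContinuousLinearMap.snd ℝ (Base n) ℝ) z :=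
      hasFDerivAt_snd
    simp [pd, this.fderiv]
  rw [this]; ring

theorem pd_testFun (a b : ℝ) (h : ContDiffAt ℝ ∞ U z) (v : Base n × ℝ) :
    pd v (testFun a b U) z = pd v (slopeFactor U) z * (a - b * z.2 - U z) +
      slopeFactor U z * (-(b * v.2) - pd v U z) := by
  rw [← pd_cut a b h v]
  exact pd_mul (contDiffAt_slopeFactor h) (contDiffAt_cut a b h)

theorem contDiffAt_testFun (a b : ℝ) (h : ContDiffAt ℝ ∞ U z) :
    ContDiffAt ℝ ∞ (testFun a b U) z :=
  (contDiffAt_slopeFactor h).mul (contDiffAt_cut a b h)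

theorem pd_pd_testFun (a b : ℝ) (h : ∀ᶠ y in 𝓝 z, ContDiffAt ℝ ∞ U y) {v w : Base n × ℝ}
    (hv : v.2 = 0) (hw : w.2 = 0) :
    pd w (pd v (testFun a b U)) z =
      pd w (pd v (slopeFactor U)) z * (a - b * z.2 - U z) - pd v (slopeFactor U) z * pd w U z -
        pd w (slopeFactor U) z * pd v U z - slopeFactor U z * pd w (pd v U) z := by
  have hz := h.self_of_nhds
  have hW := contDiffAt_slopeFactor hz
  have hc := contDiffAt_cut a b hz
  have e : pd v (testFun a b U) =ᶠ[𝓝 z] fun y => pd v (slopeFactor U) y * (a - b * y.2 - U y) -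
      slopeFactor U y * pd v U y := h.mono fun y hy => by
    rw [pd_testFun a b hy, hv]; ring
  rw [pd_congr e, pd_sub ((contDiffAt_pd hW).mul hc) (hW.mul (contDiffAt_pd hz)),
    pd_mul (contDiffAt_pd hW) hc, pd_mul hW (contDiffAt_pd hz), pd_cut a b hz, hw]
  ring

theorem span_spaceDir_snd {v : Base n × ℝ}
    (hv : v ∈ Submodule.span ℝ (Set.range (spaceDir (n := n)))) : v.2 = 0 := by
  have : Submodule.span ℝ (Set.range (spaceDir (n := n))) ≤
      LinearMap.ker (LinearMap.snd ℝ (Base n) ℝ) := by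
    rw [Submodule.span_le]
    rintro _ ⟨i, rfl⟩
    simp [spaceDir]
  simpa using this hv

/-- The inequality that holds wherever `W (a - b t - u)` has a positive maximum among the points
nearby at the same and at earlier times. It is the differential inequality
`0 ≤ (α - 1) w H^α - α H^(α-1) |A|² ψ - b`, multiplied by `W = w⁻¹`, with `|A|²` bounded below by
`H² / n`. -/
theorem interior_max_inequality (hn : 1 ≤ n) {α a b : ℝ} (hα : 0 < α)
    (h : ∀ᶠ y in 𝓝 z, ContDiffAt ℝ ∞ U y) (hH : 0 < sliceCurvature U z)
    (hflow : ∀ᶠ y in 𝓝 z, pd (timeDir n) U y = slopeFactor U y * sliceCurvature U y ^ α)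
    (hψ : 0 < a - b * z.2 - U z)
    (hspace : ∀ v : Base n × ℝ, v.2 = 0 →
      ∀ᶠ s in 𝓝 (0 : ℝ), testFun a b U (z + s • v) ≤ testFun a b U z)
    (htime : ∀ᶠ s in 𝓝[<] (0 : ℝ), testFun a b U (z + s • timeDir n) ≤ testFun a b U z) :
    0 ≤ (α - 1) * sliceCurvature U z ^ α -
      α * (slopeFactor U z * (a - b * z.2 - U z)) * sliceCurvature U z ^ (α - 1) *
        (sliceCurvature U z ^ 2 / n) - b * slopeFactor U z := by
  have hz := h.self_of_nhds
  have hW := contDiffAt_slopeFactor hz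
  have hW0 := slopeFactor_pos U z
  have hp : ∀ k, ContDiffAt ℝ ∞ (pd (spaceDir k) U) z := fun k => contDiffAt_pd hz
  have hf := contDiffAt_testFun a b hz
  have hcrit : ∀ i, (a - b * z.2 - U z) * pd (spaceDir i) (slopeFactor U) z =
      slopeFactor U z * pd (spaceDir i) U z := fun i => by
    have := pd_eq_zero_of_isLocalMax (differentiableAt_of_smooth hf)
      (hspace (spaceDir i) rfl)
    rw [pd_testFun a b hz, show (spaceDir i : Base n × ℝ).2 = 0 from rfl] at this
    linarith
  have hmax := trace_sub_quadratic_le (e := spaceDir (n := n)) (fun i => pd (spaceDir i) U z)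
    (h.mono fun y hy => contDiffAt_testFun a b hy)
    fun v hv => hspace v (span_spaceDir_snd hv)
  have hgrad := inner_grad_curvature_le hn (p := fun k => pd (spaceDir k) U z)
    (w := fun i => pd (spaceDir i) (slopeFactor U) z)
    (h := fun k => pd (spaceDir k) (sliceCurvature U) z)
    (S := fun k i => pd (spaceDir i) (pd (spaceDir k) U) z)
    (T := fun k i => pd (spaceDir i) (pd (spaceDir i) (pd (spaceDir k) U)) z)
    (w2 := fun i k => pd (spaceDir k) (pd (spaceDir i) (slopeFactor U)) z)
    (W := slopeFactor U z) (H := sliceCurvature U z) hW0 hψ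
    (fun i j => pd_comm hz) (slopeFactor_mul_self U z) (fun i => slopeFactor_mul_pd hz _)
    (fun i => slopeFactor_second h _) (sq_mul_sliceCurvature hz)
    (fun k => by
      rw [sq_mul_pd_sliceCurvature h]
      -- Third derivatives of `U` commute.
      have : ∀ i, pd (spaceDir k) (pd (spaceDir i) (pd (spaceDir i) U)) z =
          pd (spaceDir i) (pd (spaceDir i) (pd (spaceDir k) U)) z := fun i => by
        rw [pd_comm (hp i)]
        exact pd_congr (h.mono fun y hy => pd_comm hy)
      rw [Finset.sum_congr rfl fun i _ => this i])
    hcrit (by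
      rw [slopeFactor_mul_self]
      refine le_of_eq_of_le ?_ hmax
      congr 1
      · congr 1
        refine Finset.sum_congr rfl fun i _ => ?_
        rw [pd_pd_testFun a b h rfl rfl]; ring
      · refine Finset.sum_congr rfl fun i _ => Finset.sum_congr rfl fun k _ => ?_
        rw [pd_pd_testFun a b h rfl rfl])
  -- The flow equation, differentiated in space, gives the time derivative of the slope.
  have ht : ∀ k, pd (timeDir n) (pd (spaceDir k) U) z =
      pd (spaceDir k) (slopeFactor U) z * sliceCurvature U z ^ α +
        slopeFactor U z * (α * sliceCurvature U z ^ (α - 1) *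
          pd (spaceDir k) (sliceCurvature U) z) := fun k => by
    have hs := contDiffAt_sliceCurvature hz
    rw [pd_comm hz, pd_congr hflow, pd_mul hW (hs.rpow_const_of_ne hH.ne'), pd_rpow hs hH]
  have hWt := slopeFactor_mul_pd hz (timeDir n)
  have hft := pd_nonneg_of_le_left (differentiableAt_of_smooth hf) htime
  rw [pd_testFun a b hz, hflow.self_of_nhds, show (timeDir n).2 = 1 from rfl] at hft
  obtain ⟨ψ, hψe⟩ : ∃ ψ, ψ = a - b * z.2 - U z := ⟨_, rfl⟩
  obtain ⟨W, hWe⟩ : ∃ W, W = slopeFactor U z := ⟨_, rfl⟩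
  obtain ⟨H, hHe⟩ : ∃ H, H = sliceCurvature U z := ⟨_, rfl⟩
  obtain ⟨ph, hph⟩ : ∃ ph, ph = ∑ k, pd (spaceDir k) U z * pd (spaceDir k) (sliceCurvature U) z :=
    ⟨_, rfl⟩
  have hWW := slopeFactor_mul_self U z
  have hsum : ψ * ∑ k, pd (spaceDir k) U z * pd (timeDir n) (pd (spaceDir k) U) z =
      W * (W * W - 1) * H ^ α + W * α * H ^ (α - 1) * (ψ * ph) := by
    have : W * W - 1 = ∑ k, pd (spaceDir k) U z * pd (spaceDir k) U z := by
      rw [hWe, hWW]; ring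
    rw [this, hph, mul_right_comm W, Finset.mul_sum, Finset.mul_sum, Finset.mul_sum,
      Finset.mul_sum, ← Finset.sum_add_distrib]
    refine Finset.sum_congr rfl fun k _ => ?_
    have hc := hcrit k
    rw [ht, ← hWe, ← hHe]
    rw [← hWe, ← hψe] at hc
    linear_combination pd (spaceDir k) U z * H ^ α * hc
  rw [← hWt] at hsum
  simp only [← hψe, ← hWe, ← hHe, ← hph] at hgrad hft hsum hH hψ hW0 ⊢
  have hHa : H ^ α = H ^ (α - 1) * H := by
    rw [← Real.rpow_add_one hH.ne']; ring_nf
  have hb : 0 < H ^ (α - 1) := Real.rpow_pos_of_pos hH _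
  have h1 : W * α * H ^ (α - 1) * (ψ * ph) ≤
      W * α * H ^ (α - 1) * (H - W * ψ * (H ^ 2 / n)) :=
    mul_le_mul_of_nonneg_left hgrad (by positivity)
  have h2 := mul_nonneg hW0.le hft
  have h3 : 0 ≤ W * ((α - 1) * H ^ α - α * (W * ψ) * H ^ (α - 1) * (H ^ 2 / n) - b * W) := by
    linear_combination h1 + h2 + hsum - W * α * hHa
  exact nonneg_of_mul_nonneg_right h3 hW0

end

/-! ### Comparison with the gradient and mean curvature of a slice -/

section Slices

variable {n : ℕ} {U : Base n × ℝ → ℝ}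

theorem hasFDerivAt_slice {E : Type*} [NormedAddCommGroup E] [NormedSpace ℝ E] {F : E × ℝ → ℝ}
    {x : E} {t : ℝ} (h : DifferentiableAt ℝ F (x, t)) :
    HasFDerivAt (fun y => F (y, t))
      ((fderiv ℝ F (x, t)).comp (ContinuousLinearMap.inl ℝ E ℝ)) x :=
  h.hasFDerivAt.comp x (hasFDerivAt_prodMk_left x t)

theorem gradient_apply (f : Base n → ℝ) (x : Base n) (i : Fin n) :
    gradient f x i = fderiv ℝ f x (EuclideanSpace.single i 1) := by
  have h : inner ℝ (gradient f x) (EuclideanSpace.single i (1 : ℝ)) =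
      fderiv ℝ f x (EuclideanSpace.single i 1) := by
    simp [gradient]
  rw [← h, EuclideanSpace.inner_single_right]; simp

theorem gradient_slice {x : Base n} {t : ℝ} (h : DifferentiableAt ℝ U (x, t)) (i : Fin n) :
    gradient (fun y => U (y, t)) x i = pd (spaceDir i) U (x, t) := by
  rw [gradient_apply, (hasFDerivAt_slice h).fderiv]
  rfl

theorem areaFactor_slice {x : Base n} {t : ℝ} (h : DifferentiableAt ℝ U (x, t)) :
    areaFactor (fun y => U (y, t)) x = slopeFactor U (x, t) := by
  simp only [areaFactor, slopeFactor, EuclideanSpace.norm_sq_eq, gradient_slice h,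
    Real.norm_eq_abs, sq_abs, ← sq]

theorem meanCurvature_slice {x : Base n} {t : ℝ}
    (h : ∀ᶠ y in 𝓝 (x, t), ContDiffAt ℝ ∞ U y) :
    meanCurvature (fun y => U (y, t)) x = sliceCurvature U (x, t) := by
  have hz := h.self_of_nhds
  have hx : ∀ᶠ y in 𝓝 x, ContDiffAt ℝ ∞ U (y, t) :=
    (Continuous.tendsto (f := fun y : Base n => (y, t)) (by fun_prop) x).eventually h
  have hcomp : ∀ i, (fun y => ((areaFactor (fun y => U (y, t)) y)⁻¹ •
      gradient (fun y => U (y, t)) y) i) =ᶠ[𝓝 x]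
      fun y => (slopeFactor U (y, t))⁻¹ * pd (spaceDir i) U (y, t) := fun i =>
    hx.mono fun y hy => by
      have hd := differentiableAt_of_smooth hy
      simp [areaFactor_slice hd, gradient_slice hd]
  have hder : ∀ i, HasFDerivAt (fun y => ((areaFactor (fun y => U (y, t)) y)⁻¹ •
      gradient (fun y => U (y, t)) y) i) _ x := fun i =>
    (hasFDerivAt_slice (differentiableAt_of_smooth (contDiffAt_normal hz i))).congr_of_eventuallyEq
      (hcomp i)
  have hV := differentiableAt_euclidean.2 fun i => (hder i).differentiableAt
  rw [meanCurvature, divergence, sliceCurvature]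
  refine Finset.sum_congr rfl fun i _ => ?_
  have h1 := ((EuclideanSpace.proj i : Base n →L[ℝ] ℝ).hasFDerivAt.comp x
    hV.hasFDerivAt).unique (hder i)
  exact congrArg (fun L : Base n →L[ℝ] ℝ => L (EuclideanSpace.single i 1)) h1

theorem deriv_time {x : Base n} {t : ℝ} (h : DifferentiableAt ℝ U (x, t)) :
    deriv (fun s => U (x, s)) t = pd (timeDir n) U (x, t) := by
  have h2 : HasDerivAt (fun s : ℝ => (x, s)) (timeDir n) t :=
    (hasDerivAt_const t x).prodMk (hasDerivAt_id t)
  exact (h.hasFDerivAt.comp_hasDerivAt t h2).deriv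

end Slices

/-! ### The choice of the constant -/

/-- The choice of the constant excludes the inequality of `interior_max_inequality` where
`C W ψ > 1`. For `α > 1` the term `(α - 1) H^α` is absorbed by the curvature term if `H ≥ 1`,
thanks to `C ≤ α / (n (α - 1))`, and by `b W` if `H < 1`, thanks to `C ≤ b / (a (α - 1))`. -/
theorem not_max_of_large {n : ℕ} (hn : 1 ≤ n) {α a b C W ψ H : ℝ} (hα : 0 < α) (hb : 0 ≤ b)
    (hC : 0 < C) (hW : 0 < W) (hψ : 0 < ψ) (hψa : ψ ≤ a) (hH : 0 < H)
    (hlarge : 1 < C * (W * ψ))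
    (hcond : 1 < α → C ≤ α / (n * (α - 1)) ∧ C ≤ b / (a * (α - 1))) :
    (α - 1) * H ^ α - α * (W * ψ) * H ^ (α - 1) * (H ^ 2 / n) - b * W < 0 := by
  have hn' : (0 : ℝ) < n := by exact_mod_cast hn
  have ha : 0 < a := hψ.trans_le hψa
  have hHa : 0 < H ^ α := Real.rpow_pos_of_pos hH _
  have hHe : α * (W * ψ) * H ^ (α - 1) * (H ^ 2 / n) = α / n * (W * ψ) * H ^ α * H := by
    have : H ^ α = H ^ (α - 1) * H := by rw [← Real.rpow_add_one hH.ne']; ring_nf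
    rw [this]; ring
  have hpos : 0 < α / n * (W * ψ) * H ^ α * H := by positivity
  have hbW : 0 ≤ b * W := by positivity
  rw [hHe]
  rcases le_or_gt α 1 with h1 | h1
  · have : (α - 1) * H ^ α ≤ 0 := mul_nonpos_of_nonpos_of_nonneg (by linarith) hHa.le
    linarith
  · obtain ⟨c1, c2⟩ := hcond h1
    have hα1 : 0 < α - 1 := by linarith
    have hlt : (α - 1) * H ^ α < (α - 1) * C * (W * ψ) * H ^ α := by
      have := mul_lt_mul_of_pos_left hlarge (mul_pos hα1 hHa)
      linarith
    rcases le_or_gt 1 H with h2 | h2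
    · have hc : (α - 1) * C ≤ α / n := by
        rw [le_div_iff₀ (by positivity)] at c1 ⊢; linarith
      have e1 : (α - 1) * C * (W * ψ * H ^ α) ≤ α / n * (W * ψ * H ^ α) :=
        mul_le_mul_of_nonneg_right hc (by positivity)
      have e2 : α / n * (W * ψ) * H ^ α * 1 ≤ α / n * (W * ψ) * H ^ α * H :=
        mul_le_mul_of_nonneg_left h2 (by positivity)
      linarith
    · have hc : (α - 1) * C * a ≤ b := by
        rw [le_div_iff₀ (by positivity)] at c2; linarith
      have e0 : H ^ α ≤ 1 := Real.rpow_le_one hH.le h2.le hα.le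
      have e1 : (α - 1) * C * (W * ψ) * H ^ α ≤ (α - 1) * C * (W * ψ) * 1 :=
        mul_le_mul_of_nonneg_left e0 (by positivity)
      have e2 : (α - 1) * C * W * ψ ≤ (α - 1) * C * W * a :=
        mul_le_mul_of_nonneg_left hψa (by positivity)
      have e3 : (α - 1) * C * a * W ≤ b * W := mul_le_mul_of_nonneg_right hc hW.le
      linarith

/-! ### Compactness and the maximum principle -/

theorem areaFactor_pos {n : ℕ} (f : Base n → ℝ) (x : Base n) : 0 < areaFactor f x :=
  Real.sqrt_pos.2 (by positivity)

/-- `ψ⁻¹ w` is the reciprocal of `√(1 + |∇u|²) (a - b t - u)`. -/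
theorem psiInvW_eq {n : ℕ} {a b : ℝ} {u : Base n → ℝ → ℝ} {x : Base n} {t : ℝ}
    (h : 0 < a - b * t - u x t) :
    psiInvW a b u x t = (areaFactor (fun y => u y t) x * (a - b * t - u x t))⁻¹ := by
  rw [psiInvW, psi, max_eq_left h.le, normalHeight_eq, areaFactor, mul_inv, one_div, mul_comm]

theorem psi_pos_iff {n : ℕ} {a b : ℝ} {u : Base n → ℝ → ℝ} {x : Base n} {t : ℝ} :
    0 < psi a b u x t ↔ 0 < a - b * t - u x t := by
  rw [psi, lt_max_iff]; simp

theorem uniqueDiffOn_slab {n : ℕ} {T : EReal} (hT : 0 < T) : UniqueDiffOn ℝ (slab n T) := by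
  have h : slab n T = Set.univ ×ˢ {t : ℝ | 0 ≤ t ∧ (t : EReal) < T} := by
    ext; simp [slab]
  rw [h]
  refine uniqueDiffOn_univ.prod (uniqueDiffOn_convex (Set.OrdConnected.convex ⟨?_⟩) ?_)
  · rintro s hs r hr q hq
    exact ⟨hs.1.trans hq.1, (EReal.coe_le_coe_iff.2 hq.2).trans_lt hr.2⟩
  · obtain ⟨r, h0, h1⟩ := EReal.lt_iff_exists_real_btwn.1 hT
    have h0' : 0 < r := by exact_mod_cast h0
    refine ⟨r / 2, mem_interior.2 ⟨Set.Ioo 0 r, fun s hs => ⟨hs.1.le, ?_⟩, isOpen_Ioo, ?_⟩⟩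
    · exact (EReal.coe_lt_coe_iff.2 hs.2).trans h1
    · constructor <;> linarith

section Flow

variable {n : ℕ} {α a b : ℝ} {T : EReal} {Ω : Set (Base n × ℝ)} {u : Base n → ℝ → ℝ}

/-- The part of the space-time track below height `a + 1`, where the flow is smooth. -/
def smoothPart (a : ℝ) (Ω : Set (Base n × ℝ)) (u : Base n → ℝ → ℝ) : Set (Base n × ℝ) :=
  {p ∈ Ω | u p.1 p.2 < a + 1}

/-- The part of the space-time track up to height `a` and up to time `t`. -/
def sublevelUpTo (a : ℝ) (Ω : Set (Base n × ℝ)) (u : Base n → ℝ → ℝ) (t : ℝ) :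
    Set (Base n × ℝ) :=
  {p ∈ Ω | u p.1 p.2 ≤ a ∧ p.2 ≤ t}

namespace IsGraphFlowBelow

theorem mem_slab (hu : IsGraphFlowBelow n α a T Ω u)
    {p : Base n × ℝ} (hp : p ∈ Ω) : p ∈ slab n T := by
  obtain ⟨O, -, rfl⟩ := hu.isOpen_domain
  exact hp.2

theorem exists_isOpen_smoothPart (hu : IsGraphFlowBelow n α a T Ω u) :
    ∃ V : Set (Base n × ℝ), IsOpen V ∧ smoothPart a Ω u = V ∩ slab n T := by
  obtain ⟨O, hO, hΩ⟩ := hu.isOpen_domain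
  obtain ⟨V, hV, h⟩ := continuousOn_iff'.1 hu.continuousOn (Set.Iio (a + 1)) isOpen_Iio
  refine ⟨V ∩ O, hV.inter hO, ?_⟩
  rw [Set.inter_assoc, ← hΩ, ← h]
  ext p; simp [smoothPart, and_comm]

theorem uniqueDiffOn_smoothPart (hu : IsGraphFlowBelow n α a T Ω u) :
    UniqueDiffOn ℝ (smoothPart a Ω u) := by
  obtain ⟨V, hV, h⟩ := hu.exists_isOpen_smoothPart
  rcases le_or_gt T 0 with hT | hT
  · have : smoothPart a Ω u = ∅ := by
      rw [h, Set.eq_empty_iff_forall_notMem]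
      rintro p ⟨-, h0, h1⟩
      have : (p.2 : EReal) < 0 := h1.trans_le hT
      exact absurd h0 (not_le.2 (by exact_mod_cast this))
    rw [this]; exact uniqueDiffOn_empty
  · rw [h, Set.inter_comm]; exact (uniqueDiffOn_slab hT).inter hV

theorem smoothPart_mem_nhds (hu : IsGraphFlowBelow n α a T Ω u)
    {p : Base n × ℝ} (hp : p ∈ smoothPart a Ω u) (ht : 0 < p.2) :
    smoothPart a Ω u ∈ 𝓝 p := by
  obtain ⟨V, hV, h⟩ := hu.exists_isOpen_smoothPart
  rw [h] at hp ⊢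
  refine inter_mem (hV.mem_nhds hp.1) ?_
  have h1 : ∀ᶠ q : Base n × ℝ in 𝓝 p, 0 < q.2 := continuous_snd.continuousAt.eventually_const_lt ht
  have h2 : ∀ᶠ q : Base n × ℝ in 𝓝 p, (q.2 : EReal) < T :=
    (continuous_coe_real_ereal.comp continuous_snd).continuousAt.eventually_lt_const hp.2.2
  filter_upwards [h1, h2] with q h1 h2 using ⟨h1.le, h2⟩

theorem eventually_contDiffAt (hu : IsGraphFlowBelow n α a T Ω u)
    {p : Base n × ℝ} (hp : p ∈ smoothPart a Ω u) (ht : 0 < p.2) :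
    ∀ᶠ q in 𝓝 p, ContDiffAt ℝ ∞ (fun p : Base n × ℝ => u p.1 p.2) q := by
  filter_upwards [eventually_mem_nhds_iff.2 (hu.smoothPart_mem_nhds hp ht)] with q hq
  exact hu.smooth.contDiffAt hq

/-- The slope is continuous in space-time up to and including `t = 0`: there the gradient of the
time slice is read off the derivative within the domain, which is continuous because the domain has
unique derivatives. -/
theorem continuousOn_areaFactor (hu : IsGraphFlowBelow n α a T Ω u) :
    ContinuousOn (fun p : Base n × ℝ => areaFactor (fun y => u y p.2) p.1)
      (smoothPart a Ω u) := by
  obtain ⟨V, hV, hVs⟩ := hu.exists_isOpen_smoothPart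
  have hD : ∀ p ∈ smoothPart a Ω u, ‖gradient (fun y => u y p.2) p.1‖ =
      ‖(fderivWithin ℝ (fun p : Base n × ℝ => u p.1 p.2) (smoothPart a Ω u) p).comp
        (ContinuousLinearMap.inl ℝ (Base n) ℝ)‖ := fun p hp => by
    have h1 := ((hu.smooth p hp).differentiableWithinAt (by simp)).hasFDerivWithinAt
    -- The time slice through `p` is open in space, also when `p` lies at time `0`.
    have hs : ∀ᶠ y in 𝓝 p.1, (y, p.2) ∈ smoothPart a Ω u := by
      rw [hVs] at hp ⊢
      have : ∀ᶠ y in 𝓝 p.1, (y, p.2) ∈ V :=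
        (Continuous.tendsto (f := fun y : Base n => (y, p.2)) (by fun_prop) p.1).eventually
          (hV.mem_nhds hp.1)
      exact this.mono fun y hy => ⟨hy, hp.2⟩
    have h2 : HasFDerivAt (fun y => u y p.2) _ p.1 :=
      (HasFDerivWithinAt.comp (f := fun y => (y, p.2)) p.1
        (s := {y | (y, p.2) ∈ smoothPart a Ω u}) h1
        (hasFDerivAt_prodMk_left p.1 p.2).hasFDerivWithinAt fun y hy => hy).hasFDerivAt hs
    rw [gradient, h2.fderiv]
    exact LinearIsometryEquiv.norm_map _ _
  have hc : ContinuousOn (fun p => √(1 + ‖(fderivWithin ℝ (fun p : Base n × ℝ => u p.1 p.2)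
      (smoothPart a Ω u) p).comp (ContinuousLinearMap.inl ℝ (Base n) ℝ)‖ ^ 2))
      (smoothPart a Ω u) := by
    have := hu.smooth.continuousOn_fderivWithin hu.uniqueDiffOn_smoothPart (by simp)
    exact (continuousOn_const.add ((this.clm_comp continuousOn_const).norm.pow 2)).sqrt
  exact hc.congr fun p hp => by simp only [areaFactor, hD p hp]

theorem continuousOn_testFun (hu : IsGraphFlowBelow n α a T Ω u)
    (b : ℝ) :
    ContinuousOn (fun p : Base n × ℝ =>
      areaFactor (fun y => u y p.2) p.1 * (a - b * p.2 - u p.1 p.2)) (smoothPart a Ω u) :=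
  hu.continuousOn_areaFactor.mul ((by fun_prop : Continuous fun p : Base n × ℝ =>
    a - b * p.2).continuousOn.sub (hu.continuousOn.mono fun _ hp => hp.1))

theorem deriv_pos (hu : IsGraphFlowBelow n α a T Ω u)
    {x : Base n} {t : ℝ} (hx : (x, t) ∈ Ω) (ht : 0 < t) (ha : u x t < a + 1) :
    0 < deriv (fun s => u x s) t := by
  have h := hu.flow x t hx ht ha
  rw [div_eq_iff (areaFactor_pos _ _).ne'] at h
  rw [h]
  exact mul_pos (Real.rpow_pos_of_pos (hu.meanConvex x t hx ha) _) (areaFactor_pos _ _)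

/-- A point up to height `a` has been in the domain at all earlier times: going back in time its
height decreases, and the part up to height `a` is closed. -/
theorem mem_of_le (hu : IsGraphFlowBelow n α a T Ω u)
    {x : Base n} {t : ℝ} (hx : (x, t) ∈ Ω) (ha : u x t ≤ a) {s : ℝ} (hs0 : 0 ≤ s)
    (hst : s ≤ t) : (x, s) ∈ Ω ∧ u x s ≤ a := by
  obtain ⟨F, hF, hFe⟩ := hu.isClosed_sublevel
  have hmem : ∀ r, 0 ≤ r → r ≤ t → ((x, r) ∈ F ↔ (x, r) ∈ Ω ∧ u x r ≤ a) := fun r h0 h1 => by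
    have hr : (x, r) ∈ slab n T :=
      ⟨h0, (EReal.coe_le_coe_iff.2 h1).trans_lt (hu.mem_slab hx).2⟩
    have : (x, r) ∈ {p ∈ Ω | u p.1 p.2 ≤ a} ↔ (x, r) ∈ F ∩ slab n T := by rw [hFe]
    exact ⟨fun h => this.2 ⟨h, hr⟩, fun h => (this.1 h).1⟩
  have ht0 : 0 ≤ t := (hu.mem_slab hx).1
  -- Continuous induction on the elapsed time `r`, backwards from `t`.
  have key : Set.Icc 0 t ⊆ {r | (x, t - r) ∈ F} := by
    refine IsClosed.Icc_subset_of_forall_mem_nhdsWithin ?_ ?_ ?_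
    · exact (hF.preimage (by fun_prop : Continuous fun r : ℝ => (x, t - r))).inter isClosed_Icc
    · simpa using (hmem t ht0 le_rfl).2 ⟨hx, ha⟩
    · rintro r ⟨hr, hr0, hrt⟩
      obtain ⟨h1, h2⟩ := (hmem (t - r) (by linarith) (by linarith)).1 hr
      have hpos : 0 < t - r := by linarith
      have hd := hu.deriv_pos h1 hpos (by linarith)
      have hsl := (hasDerivAt_iff_tendsto_slope_left_right.1
        (differentiableAt_of_deriv_ne_zero hd.ne').hasDerivAt).1.eventually_const_lt hd
      have hnh : ∀ᶠ q in 𝓝[<] (t - r), (x, q) ∈ smoothPart a Ω u :=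
        ((Continuous.tendsto (f := fun q : ℝ => (x, q)) (by fun_prop) (t - r)).eventually
          (hu.smoothPart_mem_nhds (p := (x, t - r)) ⟨h1, by simp only; linarith⟩ hpos)).filter_mono
          nhdsWithin_le_nhds
      have hq0 : ∀ᶠ q in 𝓝[<] (t - r), 0 < q :=
        (eventually_gt_nhds hpos).filter_mono nhdsWithin_le_nhds
      have hev : ∀ᶠ q in 𝓝[<] (t - r), (x, q) ∈ F := by
        filter_upwards [hsl, hnh, hq0, self_mem_nhdsWithin] with q hq1 hq2 hq3 hq4
        have hq4' : q < t - r := hq4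
        refine (hmem q hq3.le (by linarith)).2 ⟨hq2.1, ?_⟩
        rw [slope_def_field, div_pos_iff] at hq1
        rcases hq1 with h | h
        · linarith [h.2]
        · linarith [h.1]
      have htend : Tendsto (fun q : ℝ => t - q) (𝓝[>] r) (𝓝[<] (t - r)) := by
        refine tendsto_nhdsWithin_iff.2 ⟨?_, ?_⟩
        · exact (Continuous.tendsto (by fun_prop) r).mono_left nhdsWithin_le_nhds
        · filter_upwards [self_mem_nhdsWithin] with q hq
          have : r < q := hq
          exact sub_lt_sub_left this t
      exact htend.eventually hev
  have := key (show t - s ∈ Set.Icc 0 t from ⟨by linarith, by linarith⟩)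
  rw [Set.mem_ofPred_eq, sub_sub_cancel] at this
  exact (hmem s hs0 hst).1 this

theorem initial_le (hu : IsGraphFlowBelow n α a T Ω u)
    {x : Base n} {t : ℝ} (hx : (x, t) ∈ Ω) (ha : u x t ≤ a) : u x 0 ≤ u x t := by
  have ht0 : 0 ≤ t := (hu.mem_slab hx).1
  have hc : ContinuousOn (fun s => u x s) (Set.Icc 0 t) :=
    hu.continuousOn.comp (by fun_prop : Continuous fun s : ℝ => (x, s)).continuousOn
      fun s hs => (hu.mem_of_le hx ha hs.1 hs.2).1
  have hm := strictMonoOn_of_deriv_pos (convex_Icc 0 t) hc fun s hs => by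
    rw [interior_Icc] at hs
    obtain ⟨h1, h2⟩ := hu.mem_of_le hx ha hs.1.le hs.2.le
    exact hu.deriv_pos h1 hs.1 (by linarith)
  exact hm.monotoneOn (Set.left_mem_Icc.2 ht0) (Set.right_mem_Icc.2 ht0) ht0

theorem sublevelUpTo_subset (t : ℝ) : sublevelUpTo a Ω u t ⊆ smoothPart a Ω u :=
  fun p hp => ⟨hp.1, by linarith [hp.2.1]⟩

/-- All time slices lie over the compact slice at `t = 0`, so nothing comes in from spatial
infinity. -/
theorem isCompact_sublevelUpTo (hu : IsGraphFlowBelow n α a T Ω u)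
    {t : ℝ} (h0 : 0 ≤ t) (hT : (t : EReal) < T) :
    IsCompact (sublevelUpTo a Ω u t) := by
  obtain ⟨F, hF, hFe⟩ := hu.isClosed_sublevel
  have he : sublevelUpTo a Ω u t = F ∩ Set.univ ×ˢ Set.Icc 0 t := by
    have : sublevelUpTo a Ω u t = {p ∈ Ω | u p.1 p.2 ≤ a} ∩ {p | p.2 ≤ t} := by
      ext p; exact and_assoc.symm
    rw [this, hFe]
    ext p
    simp only [slab, Set.mem_inter_iff, Set.mem_ofPred_eq, Set.mem_prod, Set.mem_univ, true_and,
      Set.mem_Icc]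
    exact ⟨fun h => ⟨h.1.1, h.1.2.1, h.2⟩, fun h => ⟨⟨h.1, h.2.1,
      (EReal.coe_le_coe_iff.2 h.2.2).trans_lt hT⟩, h.2.2⟩⟩
  refine IsCompact.of_isClosed_subset
    ((hu.isCompact_sublevel 0 le_rfl ((EReal.coe_le_coe_iff.2 h0).trans_lt hT)).prod
      (isCompact_Icc (a := 0) (b := t))) ?_ ?_
  · rw [he]; exact hF.inter (isClosed_univ.prod isClosed_Icc)
  · intro p hp
    have hp0 : 0 ≤ p.2 := (hu.mem_slab hp.1).1
    exact ⟨hu.mem_of_le (x := p.1) (t := p.2) hp.1 hp.2.1 le_rfl hp0, hp0, hp.2.2⟩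

theorem height_lt (hu : IsGraphFlowBelow n α a T Ω u)
    {x : Base n} {t : ℝ} (hb : 0 ≤ b) (hx : (x, t) ∈ Ω)
    (hψ : 0 < a - b * t - u x t) : u x t < a := by
  have := mul_nonneg hb (hu.mem_slab hx).1
  simp only at this
  linarith

/-- The infimum is over a nonempty set, since the point `(x, t)` can be followed back to `t = 0`,
and it is positive since the slope is bounded on a compact set. -/
theorem initialInf_pos (hu : IsGraphFlowBelow n α a T Ω u)
    {x : Base n} {t : ℝ} (hb : 0 ≤ b) (hx : (x, t) ∈ Ω)
    (hψ : 0 < a - b * t - u x t) : 0 < initialInf a b Ω u := by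
  have hlt := hu.height_lt hb hx hψ
  have ht0 : 0 ≤ t := (hu.mem_slab hx).1
  have hx0 := hu.mem_of_le hx hlt.le le_rfl ht0
  have hle := hu.initial_le hx hlt.le
  obtain ⟨B, hB⟩ := (hu.isCompact_sublevelUpTo (le_refl 0) (hu.mem_slab hx0.1).2).bddAbove_image
    ((hu.continuousOn_testFun b).mono (sublevelUpTo_subset 0))
  have hB' : ∀ y, (y, (0 : ℝ)) ∈ Ω → 0 < a - b * 0 - u y 0 →
      areaFactor (fun z => u z 0) y * (a - b * 0 - u y 0) ≤ B := fun y hy hy2 =>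
    hB ⟨(y, 0), ⟨hy, (hu.height_lt hb hy hy2).le, le_rfl⟩, rfl⟩
  have hψ0 : 0 < a - b * 0 - u x 0 := by linarith
  have hBpos : 0 < B := (mul_pos (areaFactor_pos _ _) hψ0).trans_le (hB' x hx0.1 hψ0)
  refine (inv_pos.2 hBpos).trans_le (le_csInf ⟨_, x, ⟨hx0.1, psi_pos_iff.2 hψ0⟩, rfl⟩ ?_)
  rintro _ ⟨y, ⟨hy, hy2⟩, rfl⟩
  rw [psi_pos_iff] at hy2
  simp only [psiInvW_eq hy2]
  exact inv_anti₀ (mul_pos (areaFactor_pos _ _) hy2) (hB' y hy hy2)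

theorem initialInf_le {x : Base n} (hx : (x, (0 : ℝ)) ∈ Ω) (hψ : 0 < psi a b u x 0) :
    initialInf a b Ω u ≤ psiInvW a b u x 0 := by
  refine csInf_le ⟨0, ?_⟩ ⟨x, ⟨hx, hψ⟩, rfl⟩
  rintro _ ⟨y, ⟨-, hy⟩, rfl⟩
  rw [psi_pos_iff] at hy
  simp only [psiInvW_eq hy]
  exact (inv_pos.2 (mul_pos (areaFactor_pos _ _) hy)).le

/-- The maximum principle for `√(1 + |∇u|²) (a - b t - u)` on the compact track up to height `a`:
a value above `1 / C` is excluded at `t = 0` by the initial infimum, and at an interior maximum by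
the evolution inequality. -/
theorem psiInvW_ge (hu : IsGraphFlowBelow n α a T Ω u)
    (hn : 1 ≤ n) (hα : 0 < α) (hb : 0 ≤ b) {C : ℝ} (hC : 0 < C)
    (hC0 : C ≤ initialInf a b Ω u)
    (hcond : 1 < α → C ≤ α / (n * (α - 1)) ∧ C ≤ b / (a * (α - 1)))
    {x : Base n} {t : ℝ} (hx : (x, t) ∈ Ω) (hψ : 0 < a - b * t - u x t) :
    C ≤ psiInvW a b u x t := by
  set f : Base n × ℝ → ℝ := fun p =>
    areaFactor (fun y => u y p.2) p.1 * (a - b * p.2 - u p.1 p.2) with hf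
  set U : Base n × ℝ → ℝ := fun p => u p.1 p.2 with hU
  obtain ⟨ht0, htT⟩ := hu.mem_slab hx
  have hxK : (x, t) ∈ sublevelUpTo a Ω u t := ⟨hx, (hu.height_lt hb hx hψ).le, le_rfl⟩
  obtain ⟨⟨x₀, t₀⟩, hzK, hmax⟩ := (hu.isCompact_sublevelUpTo ht0 htT).exists_isMaxOn ⟨_, hxK⟩
    ((hu.continuousOn_testFun b).mono (sublevelUpTo_subset t))
  have hfx : 0 < f (x, t) := mul_pos (areaFactor_pos _ _) hψ
  have hle : f (x, t) ≤ f (x₀, t₀) := hmax hxK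
  by_contra! hlt
  rw [psiInvW_eq hψ] at hlt
  have hlarge : 1 < C * f (x₀, t₀) :=
    ((inv_lt_iff_one_lt_mul₀ hfx).1 hlt).trans_le (mul_le_mul_of_nonneg_left hle hC.le)
  have hf0 : 0 < f (x₀, t₀) := hfx.trans_le hle
  have hψ0 : 0 < a - b * t₀ - u x₀ t₀ := pos_of_mul_pos_right hf0 (areaFactor_pos _ _).le
  rcases (hu.mem_slab hzK.1).1.eq_or_lt with h0 | h0
  · simp only at h0
    subst h0
    have h1 := hC0.trans (initialInf_le hzK.1 (psi_pos_iff.2 hψ0))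
    rw [psiInvW_eq hψ0] at h1
    have h2 := mul_le_mul_of_nonneg_right h1 hf0.le
    rw [inv_mul_cancel₀ hf0.ne'] at h2
    exact absurd hlarge (not_lt.2 h2)
  · have hzD := sublevelUpTo_subset t hzK
    have hsm := hu.eventually_contDiffAt hzD h0
    have hnear : ∀ᶠ q in 𝓝 (x₀, t₀), q ∈ smoothPart a Ω u ∧ 0 < q.2 :=
      (eventually_mem_set.2 (hu.smoothPart_mem_nhds hzD h0)).and
        (continuous_snd.continuousAt.eventually_const_lt h0)
    have harea : ∀ q ∈ smoothPart a Ω u, 0 < q.2 →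
        areaFactor (fun y => u y q.2) q.1 = slopeFactor U q := fun q hq hq0 =>
      areaFactor_slice (U := U) (x := q.1) (t := q.2)
        (differentiableAt_of_smooth (hu.eventually_contDiffAt hq hq0).self_of_nhds)
    have hcurv : ∀ q ∈ smoothPart a Ω u, 0 < q.2 →
        meanCurvature (fun y => u y q.2) q.1 = sliceCurvature U q := fun q hq hq0 =>
      meanCurvature_slice (U := U) (x := q.1) (t := q.2) (hu.eventually_contDiffAt hq hq0)
    have hH : 0 < sliceCurvature U (x₀, t₀) := by
      rw [← hcurv _ hzD h0]; exact hu.meanConvex _ _ hzD.1 hzD.2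
    have hflow : ∀ᶠ q in 𝓝 (x₀, t₀),
        pd (timeDir n) U q = slopeFactor U q * sliceCurvature U q ^ α := by
      filter_upwards [hnear] with q ⟨hq, hq0⟩
      rw [← hcurv q hq hq0, ← hu.flow q.1 q.2 hq.1 hq0 hq.2, ← harea q hq hq0,
        mul_div_cancel₀ _ (areaFactor_pos _ _).ne']
      exact (deriv_time (U := U) (x := q.1) (t := q.2)
        (differentiableAt_of_smooth (hu.eventually_contDiffAt hq hq0).self_of_nhds)).symm
    have hlt0 : ∀ᶠ q in 𝓝 (x₀, t₀), U q < a :=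
      hsm.self_of_nhds.continuousAt.eventually_lt_const (hu.height_lt hb hzK.1 hψ0)
    have htest : ∀ q ∈ smoothPart a Ω u, 0 < q.2 → testFun a b U q = f q := fun q hq hq0 => by
      simp only [testFun, hf, harea q hq hq0]; rfl
    have hloc : ∀ᶠ q in 𝓝 (x₀, t₀), q.2 ≤ t₀ → testFun a b U q ≤ testFun a b U (x₀, t₀) := by
      filter_upwards [hnear, hlt0] with q ⟨hq, hq0⟩ hqa hqt
      rw [htest q hq hq0, htest _ hzD h0]
      exact hmax ⟨hq.1, hqa.le, hqt.trans hzK.2.2⟩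
    have hineq := interior_max_inequality hn hα hsm hH hflow hψ0
      (fun v hv => (tendsto_line.eventually hloc).mono fun s hs => hs (by simp [hv]))
      (((tendsto_line.eventually hloc).filter_mono nhdsWithin_le_nhds).mp
        (eventually_mem_nhdsWithin.mono fun s hs0 hs => hs (by
          have : s < 0 := hs0
          simp [timeDir, this.le])))
    refine absurd hineq (not_le.2 (not_max_of_large hn hα hb hC (slopeFactor_pos U _) hψ0 ?_ hH ?_
      hcond))
    -- The cut-off is at most `a` because `u` and `b t` are nonnegative.
    · have := hu.nonneg _ _ hzK.1
      have := mul_nonneg hb h0.le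
      simp only [hU] at *
      linarith
    · rw [← harea _ hzD h0]; exact hlarge

end IsGraphFlowBelow

end Flow

end HAlphaFlow

theorem mainTheorem4 (n : ℕ) (hn : 1 ≤ n) (α a b : ℝ) (hα : 0 < α) (hb : 0 ≤ b) (T : EReal)
    (Ω : Set (HAlphaFlow.Base n × ℝ)) (u : HAlphaFlow.Base n → ℝ → ℝ)
    (hu : HAlphaFlow.IsGraphFlowBelow n α a T Ω u) :
    ∀ x t, (x, t) ∈ Ω → 0 < HAlphaFlow.psi a b u x t →
      HAlphaFlow.gradientConst α a b Ω u ≤ HAlphaFlow.psiInvW a b u x t ∧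
      ((α ≤ 1 ∨ 0 < b) →
        0 < HAlphaFlow.gradientConst α a b Ω u ∧
        √(1 + ‖gradient (fun y => u y t) x‖ ^ 2) ≤
          (HAlphaFlow.gradientConst α a b Ω u * HAlphaFlow.psi a b u x t)⁻¹) := by
  intro x t hx hψ
  have hψ' := HAlphaFlow.psi_pos_iff.1 hψ
  have hA := HAlphaFlow.areaFactor_pos (fun y => u y t) x
  have hge : HAlphaFlow.gradientConst α a b Ω u ≤ HAlphaFlow.psiInvW a b u x t := by
    rcases le_or_gt (HAlphaFlow.gradientConst α a b Ω u) 0 with hC | hC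
    · rw [HAlphaFlow.psiInvW_eq hψ']
      exact hC.trans (by positivity)
    · refine hu.psiInvW_ge hn hα hb hC ?_ ?_ hx hψ'
      · unfold HAlphaFlow.gradientConst
        split_ifs
        · exact le_rfl
        · exact min_le_left _ _
      · intro h1
        rw [HAlphaFlow.gradientConst, if_neg (not_le.2 h1)]
        exact ⟨(min_le_right _ _).trans (min_le_left _ _),
          (min_le_right _ _).trans (min_le_right _ _)⟩
  refine ⟨hge, fun hor => ?_⟩
  have hpos : 0 < HAlphaFlow.gradientConst α a b Ω u := by
    have h0 := hu.initialInf_pos hb hx hψ'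
    unfold HAlphaFlow.gradientConst
    split_ifs with h1
    · exact h0
    · have h1 : 1 < α := not_le.1 h1
      have hb' : 0 < b := hor.resolve_left (not_le.2 h1)
      have ha : 0 < a := (hu.nonneg x t hx).trans_lt (hu.height_lt hb hx hψ')
      have hα1 : 0 < α - 1 := by linarith
      have hn' : (0 : ℝ) < n := by exact_mod_cast hn
      exact lt_min h0 (lt_min (by positivity) (by positivity))
  refine ⟨hpos, ?_⟩
  rw [HAlphaFlow.psiInvW_eq hψ'] at hge
  rw [HAlphaFlow.psi, max_eq_left hψ'.le]
  change HAlphaFlow.areaFactor (fun y => u y t) x ≤ _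
  rw [le_inv_comm₀ (by positivity) (by positivity)] at hge
  rw [mul_inv, ← div_eq_mul_inv, le_div_iff₀ hψ']
  exact hge
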